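/- Let $I_1,\dots,I_r$ ($r\ge 1$) be finite sets with $|I_j|\ge 3$, and $I=I_1\sqcup\dots\sqcup I_r$. Let $d_i$ ($i\in I$) be positive integers with $\sum_{i\in I_j}1/d_i=1$ for every $j$, put $d=\mathrm{lcm}(d_i)$, $q_i=d/d_i$, and write $e_i$ for the standard basis of $\mathbb{Z}^I$ and $e_{K}=\sum_{i\in K}e_i$. Let $\overline{M}\subset\mathbb{Z}^I$ be a sublattice that contains all $d_ie_i$ and all $e_{I_j}$, and such that $d$ divides $\sum_i q_im_i$ for all $m\in\overline{M}$. Let $\Xi_0$ be the finite set of those $p\in\overline{M}$ with $p_i\ge 0$ for all $i$, $\sum_i p_i/d_i=1$, and, for every $j$, $p_i=0$ for at least two $i\in I_j$. Let $\lambda\in(\mathbb{R}_{>0})^{\Xi_0}$. Let $\pi:\mathbb{R}^I\to\widetilde{M}_{\mathbb{R}}:=\mathbb{R}^I/\langle e_{I_1},\dots,e_{I_r}\rangle_{\mathbb{R}}$ be the projection. Let $\widetilde\Sigma'$ be the fan in $\widetilde{M}_{\mathbb{R}}$ whose cones are generated by the sets $\{\pi(e_i):i\in K\}$, where $K\subset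 I$ contains none of the $I_j$ (the fan of $\prod_j\mathbb{P}^{|I_j|-1}$). Let $\psi_\lambda:\widetilde{M}_{\mathbb{R}}\to\mathbb{R}$ be the smallest concave function (concave functions are called "convex" in the toric literature) such that $\psi_\lambda(t\,\pi(p))\ge -t\lambda_p$ for all $t\ge 0$ and $p\in\Xi_0$, and let $\widetilde\Sigma_\lambda$ be the fan formed by the domains of linearity of $\psi_\lambda$ and their faces, i.e. by the cones $\{x:\psi_\lambda(x)=m(x)\}$ for linear functionals $m\ge\psi_\lambda$. The MPCP condition says that $\widetilde\Sigma_\lambda$ is a projective simplicial refinement of $\widetilde\Sigma'$ whose set of rays is exactly $\{\mathbb{R}_{\ge0}\,\pi(p):p\in\Xi_0\}$. Let $\Lambda=\{\sum_{k=0}^\infty c_kq^{a_k}:c_k\in\mathbb{C},\ a_k\in\mathbb{R},\ a_k\to+\infty\}$ be the universal Novikov field, with its valuation $\mathrm{val}:\Lambda\to\mathbb{R}\cup\{\infty\}$ (the smallest exponent occurring with nonzero coefficient). For $b\in\Lambda^{\Xi_0}$ put $$W_b(z)=-\sum_{j=1}^r z^{e_{I_j}}+\sum_{p\in\Xi_0}b_p\,z^p\in\Lambda[z_i]_{i\in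 I}.$$ If the MPCP condition holds, then for every $b\in\Lambda^{\Xi_0}$ with $\mathrm{val}(b_p)=\lambda_p$ for all $p\in\Xi_0$, the polynomial $W_b$ has an isolated singularity at the origin: $W_b(0)=0$, all partial derivatives of $W_b$ vanish at $0$, and $0$ is an isolated point (in the Zariski topology of $\Lambda^I$) of the set of common zeros of the partial derivatives $\partial W_b/\partial z_i$. -/

import Mathlib

/-! ### The universal Novikov field -/

/-- The universal Novikov field, realised inside the field of Hahn series in `q` with real exponents
and complex coefficients: the series with only finitely many terms below any given exponent, that
is, the series `∑ c_j q ^ λ_j` with `λ_j → + ∞`. -/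
def novikovSubfield : Subfield (HahnSeries ℝ ℂ) where
  carrier := {f | ∀ c : ℝ, (f.support ∩ Set.Iic c).Finite}
  zero_mem' := by intro c; simp
  one_mem' := by intro c; exact (Set.finite_singleton (0 : ℝ)).subset (by
    rw [HahnSeries.support_one]; exact Set.inter_subset_left)
  add_mem' := by
    intro f g hf hg c
    refine ((hf c).union (hg c)).subset ?_
    rintro x ⟨hx, hxc⟩
    rcases HahnSeries.support_add_subset f g hx with h | h
    · exact Or.inl ⟨h, hxc⟩
    · exact Or.inr ⟨h, hxc⟩
  neg_mem' := by
    intro f hf c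
    rw [HahnSeries.support_neg]
    exact hf c
  mul_mem' := by
    intro f g hf hg c
    by_cases hf0 : f = 0
    · subst hf0; simp
    by_cases hg0 : g = 0
    · subst hg0; simp
    refine (Set.Finite.image2 (fun x y : ℝ => x + y) (hf (c - g.order)) (hg (c - f.order))).subset ?_
    rintro x ⟨hx, hxc⟩
    obtain ⟨u, hu, v, hv, huv⟩ := Set.mem_add.1 (HahnSeries.support_mul_subset hx)
    have h1 : f.order ≤ u := HahnSeries.order_le_of_coeff_ne_zero hu
    have h2 : g.order ≤ v := HahnSeries.order_le_of_coeff_ne_zero hv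
    have hxc' : x ≤ c := hxc
    exact ⟨u, ⟨hu, by simp only [Set.mem_Iic]; linarith⟩,
      v, ⟨hv, by simp only [Set.mem_Iic]; linarith⟩, huv⟩
  inv_mem' := by
    intro f hf
    by_cases hf0 : f = 0
    · subst hf0; intro c; simp
    set h := f⁻¹ with hh
    have hfh : f * h = 1 := mul_inv_cancel₀ hf0
    have hh0 : h ≠ 0 := inv_ne_zero hf0
    set a := f.order with ha
    set t := HahnSeries.single a f.leadingCoeff with ht
    have htl : f.leadingCoeff ≠ 0 := HahnSeries.leadingCoeff_ne_zero.2 hf0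
    -- the part of `f` above its leading term
    set g := f - t with hg
    have hgsub : ∀ x ∈ g.support, x ∈ f.support ∧ a < x := by
      intro x hx
      have hxa : x ≠ a := by
        rintro rfl
        apply hx
        simp [hg, ht, HahnSeries.leadingCoeff_eq, ha]
      have hxf : x ∈ f.support := by
        intro h0
        apply hx
        simp only [hg, ht, HahnSeries.coeff_sub]
        rw [h0, HahnSeries.coeff_single_of_ne hxa, sub_zero]
      exact ⟨hxf, lt_of_le_of_ne (HahnSeries.order_le_of_coeff_ne_zero hxf) (Ne.symm hxa)⟩
    obtain ⟨ε, hε, hgap⟩ : ∃ ε : ℝ, 0 < ε ∧ ∀ x ∈ g.support, a + ε ≤ x := by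
      by_cases hg0 : g = 0
      · exact ⟨1, one_pos, by intro x hx; simp [hg0] at hx⟩
      · refine ⟨g.order - a, sub_pos.2 (hgsub _ ?_).2, ?_⟩
        · exact HahnSeries.coeff_order_eq_zero.not.2 hg0
        · intro x hx
          have := HahnSeries.order_le_of_coeff_ne_zero hx
          linarith
    have hrec : ∀ x ∈ h.support, x = -a ∨ ∃ u ∈ g.support, ∃ v ∈ h.support, u + v = x + a := by
      intro x hx
      by_contra hcon
      push Not at hcon
      have h1 : (f * h).coeff (x + a) = 0 := by
        rw [hfh, HahnSeries.coeff_one, if_neg]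
        intro h0; exact hcon.1 (by linarith)
      have h2 : f * h = t * h + g * h := by rw [hg]; ring
      have h3 : (g * h).coeff (x + a) = 0 := by
        by_contra h0
        obtain ⟨u, hu, v, hv, huv⟩ := Set.mem_add.1 (HahnSeries.support_mul_subset h0)
        exact hcon.2 u hu v hv huv
      rw [h2, HahnSeries.coeff_add, h3, add_zero, ht, HahnSeries.coeff_single_mul_add] at h1
      exact (mul_ne_zero htl hx) h1
    have key : ∀ n : ℕ, (h.support ∩ Set.Iic (h.order + n * ε)).Finite := by
      intro n
      induction n with
      | zero =>
        refine (Set.finite_singleton h.order).subset ?_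
        rintro x ⟨hx, hxc⟩
        have h1 := HahnSeries.order_le_of_coeff_ne_zero hx
        simp only [Set.mem_Iic, Nat.cast_zero, zero_mul, add_zero] at hxc
        exact le_antisymm hxc h1
      | succ n ih =>
        refine ((Set.finite_singleton (-a)).union (Set.Finite.image2 (fun u v : ℝ => u + v - a)
          (hf (a + (n + 1) * ε)) ih)).subset ?_
        rintro x ⟨hx, hxc⟩
        simp only [Set.mem_Iic, Nat.cast_succ] at hxc
        rcases hrec x hx with h1 | ⟨u, hu, v, hv, huv⟩
        · exact Or.inl h1
        · have h2 := HahnSeries.order_le_of_coeff_ne_zero hv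
          have h3 := hgap u hu
          exact Or.inr ⟨u, ⟨(hgsub u hu).1, by simp only [Set.mem_Iic]; linarith⟩,
            v, ⟨hv, by simp only [Set.mem_Iic]; linarith⟩, by linarith⟩
    intro c
    obtain ⟨n, hn⟩ := exists_nat_ge ((c - h.order) / ε)
    refine (key n).subset ?_
    rintro x ⟨hx, hxc⟩
    refine ⟨hx, ?_⟩
    rw [div_le_iff₀ hε] at hn
    simp only [Set.mem_Iic] at hxc ⊢
    linarith

/-- The universal Novikov field `Λ`. -/
abbrev Novikov : Type := novikovSubfield

/-- The valuation on the Novikov field: the smallest exponent that occurs in a series with nonzero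
coefficient, and `⊤` for the zero series. -/
noncomputable def Novikov.val (f : Novikov) : WithTop ℝ := (f : HahnSeries ℝ ℂ).orderTop

/-! ### Isolated singularities of polynomials -/

/-- The critical points of a polynomial: the common zeros of all its partial derivatives. -/
def criticalLocus {σ k : Type*} [Field k] (W : MvPolynomial σ k) : Set (σ → k) :=
  {z | ∀ i, MvPolynomial.eval z (MvPolynomial.pderiv i W) = 0}

/-- `W` vanishes and is critical at the origin, and the origin is an isolated point of the
critical locus: some Zariski neighbourhood `{g ≠ 0}` of the origin contains no other critical
point. -/
def HasIsolatedSingularityAtOrigin {σ k : Type*} [Field k] (W : MvPolynomial σ k) : Prop :=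
  MvPolynomial.eval 0 W = 0 ∧ (0 : σ → k) ∈ criticalLocus W ∧
    ∃ g : MvPolynomial σ k, MvPolynomial.eval 0 g ≠ 0 ∧
      ∀ z ∈ criticalLocus W, MvPolynomial.eval z g ≠ 0 → z = 0

/-! ### Fans in a real vector space, as sets of cones -/

section Fans

variable {E : Type*} [AddCommGroup E] [Module ℝ E]

/-- The decomposition of `E` into the domains of linearity of a concave, positively homogeneous
piecewise linear function `ψ`. The cones are the loci where `ψ` agrees with a linear functional `m`
that dominates it: the maximal ones are the maximal domains of linearity, and the others are the
faces of these. -/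
def linearityFan (ψ : E → ℝ) : Set (PointedCone ℝ E) :=
  {τ | ∃ m : E →ₗ[ℝ] ℝ, (∀ x, ψ x ≤ m x) ∧ ∀ x, x ∈ τ ↔ ψ x = m x}

/-- Every cone is generated by a finite linearly independent set. -/
def IsSimplicialFan (F : Set (PointedCone ℝ E)) : Prop :=
  ∀ τ ∈ F, ∃ s : Set E, s.Finite ∧ LinearIndepOn ℝ id s ∧ τ = PointedCone.hull ℝ s

/-- `F` is the fan of domains of linearity of a (strictly convex, in the toric terminology)
support function. -/
def IsProjectiveFan (F : Set (PointedCone ℝ E)) : Prop :=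
  ∃ φ : E → ℝ, ConcaveOn ℝ Set.univ φ ∧ (∀ (t : ℝ) (x : E), 0 ≤ t → φ (t • x) = t * φ x) ∧
    F = linearityFan φ

/-- `F` refines `F'`: both have the same support, and each cone of `F` lies in a cone of `F'`. -/
def FanRefines (F F' : Set (PointedCone ℝ E)) : Prop :=
  (⋃ τ ∈ F, (τ : Set E)) = (⋃ τ ∈ F', (τ : Set E)) ∧ ∀ τ ∈ F, ∃ τ' ∈ F', τ ≤ τ'

/-- The one-dimensional cones of a fan. -/
def fanRays (F : Set (PointedCone ℝ E)) : Set (PointedCone ℝ E) :=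
  {τ ∈ F | ∃ v : E, v ≠ 0 ∧ τ = PointedCone.hull ℝ {v}}

end Fans

/-! ### Toric data of generalized Greene--Plesser mirrors -/

/-- The lattice data: finite sets `I 0, …, I (r - 1)`, `r ≥ 1`, with at least three elements each, positive
integers `d i` for `i` in their disjoint union, and a sublattice `M` of the lattice of integer
vectors indexed by the disjoint union. -/
structure GreenePlesserData {r : ℕ} (I : Fin r → Type*) [∀ j, Fintype (I j)]
    [∀ j, DecidableEq (I j)] where
  d : (Σ j, I j) → ℕ
  M : AddSubgroup ((Σ j, I j) → ℤ)
  r_pos : 0 < r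
  three_le_card : ∀ j, 3 ≤ Fintype.card (I j)
  d_pos : ∀ i, 0 < d i
  sum_inv_d : ∀ j, ∑ i : I j, 1 / (d ⟨j, i⟩ : ℚ) = 1
  single_mem : ∀ i, Pi.single i (d i : ℤ) ∈ M
  block_mem : ∀ j, (fun i : Σ j, I j => if i.1 = j then (1 : ℤ) else 0) ∈ M
  lcm_dvd : ∀ m ∈ M,
    ((Finset.univ.lcm d : ℕ) : ℤ) ∣ ∑ i, ((Finset.univ.lcm d / d i : ℕ) : ℤ) * m i

namespace GreenePlesserData

variable {r : ℕ} {I : Fin r → Type*} [∀ j, Fintype (I j)] [∀ j, DecidableEq (I j)]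

/-- The integer vector `e_{I_j}`, the sum of the standard basis vectors of the `j`-th block. -/
def blockZ (I : Fin r → Type*) (j : Fin r) : (Σ j, I j) → ℤ := fun i => if i.1 = j then 1 else 0

/-- The vector `e_{I_j}`, with real entries. -/
def blockR (I : Fin r → Type*) (j : Fin r) : (Σ j, I j) → ℝ := fun i => if i.1 = j then 1 else 0

/-- The real vector space `(ℤ ^ I / ℤ ^ r) ⊗ ℝ`, the quotient of `ℝ ^ I` by the span of the vectors
`e_{I_j}`. -/
abbrev MTilde (I : Fin r → Type*) : Type _ :=
  ((Σ j, I j) → ℝ) ⧸ Submodule.span ℝ (Set.range (blockR I))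

/-- The projection from `ℝ ^ I`. -/
abbrev proj (I : Fin r → Type*) : ((Σ j, I j) → ℝ) →ₗ[ℝ] MTilde I :=
  (Submodule.span ℝ (Set.range (blockR I))).mkQ

variable (D : GreenePlesserData I)

/-- The least common multiple of the numbers `d i`. -/
def dLcm : ℕ := Finset.univ.lcm D.d

/-- The weights `q i = d / d i`. -/
def q (i : Σ j, I j) : ℕ := D.dLcm / D.d i

/-- The vector `n_σ = q / d`. -/
noncomputable def nSigma (i : Σ j, I j) : ℝ := (D.q i : ℝ) / (D.dLcm : ℝ)

/-- The simplex of all points of the positive orthant that pair to `1` with `n_σ`. -/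
def simplex : Set ((Σ j, I j) → ℝ) := {m | (∀ i, 0 ≤ m i) ∧ ∑ i, D.nSigma i * m i = 1}

/-- The lattice points of the simplex. -/
def Xi : Set ((Σ j, I j) → ℤ) := {p | p ∈ D.M ∧ (fun i => (p i : ℝ)) ∈ D.simplex}

/-- The lattice points of the simplex with at least two zero coordinates in each block. -/
def Xi0 : Set ((Σ j, I j) → ℤ) :=
  {p ∈ D.Xi | ∀ j, 2 ≤ (Finset.univ.filter fun i : I j => p ⟨j, i⟩ = 0).card}

theorem nSigma_eq (i : Σ j, I j) : D.nSigma i = 1 / (D.d i : ℝ) := by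
  have h1 : D.d i ∣ D.dLcm := Finset.dvd_lcm (Finset.mem_univ i)
  have h2 : (D.d i : ℝ) ≠ 0 := by exact_mod_cast (D.d_pos i).ne'
  have h3 : D.dLcm ≠ 0 := by
    intro h
    obtain ⟨k, -, hk⟩ := (Finset.lcm_eq_zero_iff (s := Finset.univ) (f := D.d)).1 h
    exact (D.d_pos k).ne' hk
  have h4 : (D.dLcm : ℝ) ≠ 0 := by exact_mod_cast h3
  rw [nSigma, q, Nat.cast_div h1 h2]
  field_simp

theorem finite_Xi : D.Xi.Finite := by
  refine (Set.finite_Icc (0 : (Σ j, I j) → ℤ) (fun i => (D.d i : ℤ))).subset ?_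
  rintro p ⟨-, hp0, hp1⟩
  refine ⟨fun i => by have := hp0 i; simp only [Int.cast_nonneg_iff] at this; simpa using this,
    fun i => ?_⟩
  have hd : (0 : ℝ) < D.d i := by exact_mod_cast D.d_pos i
  have h1 : D.nSigma i * (p i : ℝ) ≤ 1 := by
    rw [← hp1]
    refine Finset.single_le_sum (f := fun k => D.nSigma k * (p k : ℝ)) (fun k _ => ?_)
      (Finset.mem_univ i)
    exact mul_nonneg (by rw [nSigma_eq]; positivity) (hp0 k)
  rw [nSigma_eq, one_div, inv_mul_le_iff₀ hd, mul_one] at h1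
  exact_mod_cast h1

noncomputable instance : Fintype D.Xi0 :=
  (D.finite_Xi.subset (fun _ h => h.1)).fintype

/-- The image of an element of `Xi0` in `MTilde I`. -/
def projXi (p : D.Xi0) : MTilde I := proj I (fun i => ((p : (Σ j, I j) → ℤ) i : ℝ))

/-- The concave functions `f` with `f (t • π p) ≥ - t * λ_p` for all `t ≥ 0` and all `p`. -/
def supportCandidates (lam : D.Xi0 → ℝ) : Set (MTilde I → ℝ) :=
  {f | ConcaveOn ℝ Set.univ f ∧ ∀ (p : D.Xi0) (t : ℝ), 0 ≤ t → -(t * lam p) ≤ f (t • D.projXi p)}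

/-- The smallest concave function `ψ_λ` with `ψ_λ (t • π p) ≥ - t * λ_p` for all `t ≥ 0` and
all `p`; it exists by `isLeast_psi` below. (Concave functions are called convex in the toric
literature.) -/
noncomputable def psi (lam : D.Xi0 → ℝ) (x : MTilde I) : ℝ :=
  sInf ((fun f : MTilde I → ℝ => f x) '' D.supportCandidates lam)

theorem single_mem_Xi0 (i : Σ j, I j) : (Pi.single i (D.d i : ℤ) : (Σ j, I j) → ℤ) ∈ D.Xi0 := by
  have hd : (D.d i : ℝ) ≠ 0 := by exact_mod_cast (D.d_pos i).ne'
  refine ⟨⟨D.single_mem i, fun k => ?_, ?_⟩, fun j => ?_⟩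
  · by_cases h : k = i
    · subst h; simp
    · simp [h]
  · rw [Finset.sum_eq_single i]
    · simp [nSigma_eq, hd]
    · intro k _ hk; simp [hk]
    · simp
  · have h3 := D.three_le_card j
    have hc : (Finset.univ.filter fun k : I j =>
        ¬ (Pi.single i (D.d i : ℤ) : (Σ j, I j) → ℤ) ⟨j, k⟩ = 0).card ≤ 1 := by
      rw [Finset.card_le_one]
      intro a ha b hb
      simp only [Finset.mem_filter, Finset.mem_univ, true_and] at ha hb
      have ha' : (⟨j, a⟩ : Σ j, I j) = i := by by_contra h; exact ha (by simp [h])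
      have hb' : (⟨j, b⟩ : Σ j, I j) = i := by by_contra h; exact hb (by simp [h])
      have := ha'.trans hb'.symm
      simpa using this
    have hs := Finset.card_filter_add_card_filter_not (s := (Finset.univ : Finset (I j)))
      (fun k : I j => (Pi.single i (D.d i : ℤ) : (Σ j, I j) → ℤ) ⟨j, k⟩ = 0)
    rw [Finset.card_univ] at hs
    omega

theorem supportCandidates_bddBelow (lam : D.Xi0 → ℝ) (x : MTilde I) :
    BddBelow ((fun f : MTilde I → ℝ => f x) '' D.supportCandidates lam) := by
  classical
  obtain ⟨y0, rfl⟩ := Submodule.mkQ_surjective _ x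
  -- move `y0` into the positive orthant
  obtain ⟨y, hy, hyy⟩ : ∃ y : (Σ j, I j) → ℝ, (∀ i, 0 ≤ y i) ∧ proj I y = proj I y0 := by
    refine ⟨y0 + ∑ j, (∑ i, |y0 i|) • blockR I j, fun i => ?_, ?_⟩
    · have h1 : (∑ j, (∑ i, |y0 i|) • blockR I j) i = ∑ i, |y0 i| := by
        simp [blockR, Finset.sum_apply]
      have h2 : |y0 i| ≤ ∑ i, |y0 i| :=
        Finset.single_le_sum (f := fun i => |y0 i|) (fun k _ => abs_nonneg _) (Finset.mem_univ i)
      rw [Pi.add_apply, h1]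
      have := neg_abs_le (y0 i)
      linarith
    · rw [map_add, add_eq_left]
      refine (Submodule.Quotient.mk_eq_zero _).2 ?_
      exact Submodule.sum_mem _ fun j _ => Submodule.smul_mem _ _ (Submodule.subset_span ⟨j, rfl⟩)
  rw [← hyy]
  have hI : Nonempty (Σ j, I j) := by
    have h3 := D.three_le_card ⟨0, D.r_pos⟩
    obtain ⟨k⟩ : Nonempty (I ⟨0, D.r_pos⟩) := Fintype.card_pos_iff.1 (by omega)
    exact ⟨⟨_, k⟩⟩
  set N : ℝ := (Fintype.card (Σ j, I j) : ℝ) with hN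
  have hN0 : 0 < N := by rw [hN]; exact_mod_cast Fintype.card_pos
  let e : (Σ j, I j) → D.Xi0 := fun i => ⟨Pi.single i (D.d i : ℤ), D.single_mem_Xi0 i⟩
  have hd : ∀ i, (0 : ℝ) < D.d i := fun i => by exact_mod_cast D.d_pos i
  have hsum : proj I y = ∑ i, (1 / N) • ((N * y i / D.d i) • D.projXi (e i)) := by
    have h1 : y = ∑ i, (y i / D.d i) • (fun k => (((e i : (Σ j, I j) → ℤ) k : ℤ) : ℝ)) := by
      funext k
      rw [Finset.sum_apply, Finset.sum_eq_single k]
      · have := (hd k).ne'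
        simp only [e, Pi.smul_apply, Pi.single_eq_same, smul_eq_mul, Int.cast_natCast]
        field_simp
      · intro i _ hik
        simp [e, Pi.single_eq_of_ne (Ne.symm hik)]
      · simp
    conv_lhs => rw [h1]
    rw [map_sum]
    refine Finset.sum_congr rfl fun i _ => ?_
    rw [map_smul, projXi, smul_smul]
    congr 1
    field_simp
  refine ⟨∑ i, (1 / N) * -((N * y i / D.d i) * lam (e i)), ?_⟩
  rintro _ ⟨f, ⟨hf, hb⟩, rfl⟩
  have hJ := hf.le_map_sum (t := Finset.univ) (w := fun _ : Σ j, I j => 1 / N)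
    (p := fun i => (N * y i / D.d i) • D.projXi (e i)) (fun _ _ => by positivity)
    (by rw [Finset.sum_const, Finset.card_univ, nsmul_eq_mul, ← hN]; field_simp)
    (fun _ _ => Set.mem_univ _)
  simp only [hsum]
  refine le_trans (Finset.sum_le_sum fun i _ => ?_) hJ
  rw [smul_eq_mul]
  refine mul_le_mul_of_nonneg_left (hb _ _ ?_) (by positivity)
  exact div_nonneg (mul_nonneg hN0.le (hy i)) (hd i).le

/-- For nonnegative `lam` the function `psi` is the smallest of the candidates. -/
theorem isLeast_psi (lam : D.Xi0 → ℝ) (hlam : ∀ p, 0 ≤ lam p) :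
    IsLeast (D.supportCandidates lam) (D.psi lam) := by
  have hne : ∀ x : MTilde I,
      ((fun f : MTilde I → ℝ => f x) '' D.supportCandidates lam).Nonempty := fun x =>
    ⟨0, fun _ => 0, ⟨concaveOn_const 0 convex_univ, fun p t ht => by
      have := mul_nonneg ht (hlam p)
      linarith⟩, rfl⟩
  have hle : ∀ f ∈ D.supportCandidates lam, ∀ x, D.psi lam x ≤ f x := fun f hf x =>
    csInf_le (D.supportCandidates_bddBelow lam x) ⟨f, hf, rfl⟩
  refine ⟨⟨⟨convex_univ, fun x _ y _ a b ha hb hab => ?_⟩, fun p t ht => ?_⟩, hle⟩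
  · refine le_csInf (hne _) ?_
    rintro _ ⟨f, hf, rfl⟩
    refine le_trans ?_ (hf.1.2 (Set.mem_univ x) (Set.mem_univ y) ha hb hab)
    simp only [smul_eq_mul]
    exact add_le_add (mul_le_mul_of_nonneg_left (hle f hf x) ha)
      (mul_le_mul_of_nonneg_left (hle f hf y) hb)
  · refine le_csInf (hne _) ?_
    rintro _ ⟨f, hf, rfl⟩
    exact hf.2 p t ht

/-- The fan of the product of the projective spaces attached to the blocks: its cones are generated
by the images of those standard basis vectors `e_i`, `i ∈ K`, for which `K` contains no block. -/
def fanPrime (I : Fin r → Type*) [∀ j, DecidableEq (I j)] : Set (PointedCone ℝ (MTilde I)) :=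
  {τ | ∃ K : Set (Σ j, I j), (∀ j, ∃ i : I j, (⟨j, i⟩ : Σ j, I j) ∉ K) ∧
    τ = PointedCone.hull ℝ ((fun i => proj I (Pi.single i (1 : ℝ))) '' K)}

/-- The fan of domains of linearity of `ψ_λ`. -/
def fanLam (lam : D.Xi0 → ℝ) : Set (PointedCone ℝ (MTilde I)) := linearityFan (D.psi lam)

/-- The MPCP condition: the fan of domains of linearity of `ψ_λ` is a projective simplicial
refinement of the fan of the product of projective spaces, and its rays are precisely the rays
generated by the projections of the elements of `Xi0`. -/
def MPCP (lam : D.Xi0 → ℝ) : Prop :=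
  IsProjectiveFan (D.fanLam lam) ∧ IsSimplicialFan (D.fanLam lam) ∧
    FanRefines (D.fanLam lam) (fanPrime I) ∧
    fanRays (D.fanLam lam) = Set.range fun p : D.Xi0 => PointedCone.hull ℝ {D.projXi p}

/-- The monomial `c * z ^ v`, for a vector `v` with nonnegative entries. -/
noncomputable def zMonomial (v : (Σ j, I j) → ℤ) (c : Novikov) :
    MvPolynomial (Σ j, I j) Novikov :=
  MvPolynomial.monomial (Finsupp.equivFunOnFinite.symm fun i => (v i).toNat) c

/-- The superpotential `W_b = - ∑_j z ^ e_{I_j} + ∑_p b_p * z ^ p`. -/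
noncomputable def W (b : D.Xi0 → Novikov) : MvPolynomial (Σ j, I j) Novikov :=
  -(∑ j, zMonomial (blockZ I j) 1) +
    ∑ p : D.Xi0, zMonomial (p : (Σ j, I j) → ℤ) (b p)

end GreenePlesserData

/-! The origin is in fact the only critical point. If z ≠ 0 is critical, the Euler relations z_i
∂W/∂z_i = 0 say that Σ_m T_m m = 0, where T_m is the term of W_b with exponent m, evaluated at z.
Some T_m is nonzero because every d_i e_i lies in Ξ_0. Let μ be the lowest valuation of the terms.
The coefficients of q^μ form a nontrivial complex linear relation between exponents at which the
tropical polynomial attains its minimum. This is absurd, since those exponents are linearly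
independent (`eq_zero_of_sum_mul_expo_eq_zero`).

For the independence, all exponents pair to 1 with n_σ, so subtracting μ n_σ from the valuation
vector gives a functional w with w(p) ≥ -λ_p and w(e_{I_j}) ≥ 0, with equality at the minimal
exponents. Such a w need not descend to the quotient, but MPCP still puts the π(p) of all tight p in
one cone of the fan of ψ_λ (`linearIndependent_projXi_of_tight`). Indeed, let y be the sum of the
tight p. Because the fan refines that of the product of projective spaces, y is an optimal conic
combination of elements of Ξ_0 plus nonnegative multiples of the e_{I_j}. Hence w(y) ≥ ψ_λ(π(y)),
and the resulting equality propagates to each tight p. The cone is simplicial and each π(p) spans a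
ray of the fan, so the π(p) are multiples of distinct generators. -/

namespace GreenePlesserData

variable {r : ℕ} {I : Fin r → Type*}

/-! ### The quotient by the block vectors and the fan of the product of projective spaces -/

theorem proj_eq_proj_iff (x y : (Σ j, I j) → ℝ) :
    proj I x = proj I y ↔ ∃ s : Fin r → ℝ, ∀ i, x i = y i + s i.1 := by
  classical
  rw [proj, ← sub_eq_zero, ← map_sub, Submodule.mkQ_apply, Submodule.Quotient.mk_eq_zero,
    Submodule.mem_span_range_iff_exists_fun]
  refine exists_congr fun s => ?_
  rw [funext_iff]
  refine forall_congr' fun i => ?_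
  have h : (∑ j, s j • blockR I j) i = s i.1 := by
    simp [blockR, Finset.sum_apply]
  rw [h, Pi.sub_apply]
  constructor <;> intro h <;> linarith

variable [∀ j, DecidableEq (I j)]

theorem mem_hull_proj_image {K : Set (Σ j, I j)} {x : MTilde I}
    (hx : x ∈ PointedCone.hull ℝ ((fun i => proj I (Pi.single i (1 : ℝ))) '' K)) :
    ∃ a : (Σ j, I j) → ℝ, (∀ i, 0 ≤ a i) ∧ (∀ i, i ∉ K → a i = 0) ∧ proj I a = x := by
  induction hx using Submodule.span_induction with
  | mem x h =>
    obtain ⟨i, hi, rfl⟩ := h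
    refine ⟨Pi.single i 1, fun k => ?_, fun k hk => ?_, rfl⟩
    · by_cases h : k = i
      · subst h; simp
      · simp [h]
    · have : k ≠ i := fun h => hk (h ▸ hi)
      simp [this]
  | zero => exact ⟨0, by simp, by simp, by simp⟩
  | add x y _ _ hx hy =>
    obtain ⟨a, ha, haK, rfl⟩ := hx
    obtain ⟨c, hc, hcK, rfl⟩ := hy
    exact ⟨a + c, fun i => add_nonneg (ha i) (hc i), fun i hi => by simp [haK i hi, hcK i hi],
      map_add _ _ _⟩
  | smul t x _ hx =>
    obtain ⟨a, ha, haK, rfl⟩ := hx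
    exact ⟨(t : ℝ) • a, fun i => mul_nonneg t.2 (ha i), fun i hi => by simp [haK i hi],
      map_smul _ _ _⟩

/-- A point of the cone lifts to a nonnegative vector supported on K, and two lifts differ by a
constant on each block. The zero of x in the block makes that constant nonpositive, while outside K
it equals the coordinate of x. -/
theorem eq_zero_of_proj_mem_hull {K : Set (Σ j, I j)} {x : (Σ j, I j) → ℝ}
    (hx : ∀ i, 0 ≤ x i)
    (hx0 : ∀ j, ∃ i : I j, x ⟨j, i⟩ = 0)
    (h : proj I x ∈ PointedCone.hull ℝ ((fun i => proj I (Pi.single i (1 : ℝ))) '' K))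
    {i : Σ j, I j} (hi : i ∉ K) : x i = 0 := by
  obtain ⟨a, ha, haK, hax⟩ := mem_hull_proj_image h
  obtain ⟨s, hs⟩ := (proj_eq_proj_iff _ _).1 hax.symm
  obtain ⟨j, k⟩ := i
  obtain ⟨k0, hk0⟩ := hx0 j
  have h1 := hs ⟨j, k0⟩
  have h2 := hs ⟨j, k⟩
  have h3 := ha ⟨j, k0⟩
  have h4 := hx ⟨j, k⟩
  rw [haK _ hi] at h2
  simp only at h1 h2
  linarith

variable [∀ j, Fintype (I j)]

theorem proj_mem_hull_of_support {K : Set (Σ j, I j)} {a : (Σ j, I j) → ℝ} (ha : ∀ i, 0 ≤ a i)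
    (haK : ∀ i, i ∉ K → a i = 0) :
    proj I a ∈ PointedCone.hull ℝ ((fun i => proj I (Pi.single i (1 : ℝ))) '' K) := by
  have h1 : proj I a = ∑ i, a i • proj I (Pi.single i (1 : ℝ)) := by
    conv_lhs => rw [pi_eq_sum_univ' a]
    rw [map_sum]
    refine Finset.sum_congr rfl fun i _ => ?_
    rw [map_smul]
  rw [h1]
  refine Submodule.sum_mem _ fun i _ => ?_
  by_cases hi : i ∈ K
  · exact Submodule.smul_mem _ (⟨a i, ha i⟩ : {c : ℝ // 0 ≤ c}) (Submodule.subset_span ⟨i, hi, rfl⟩)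
  · rw [haK i hi, zero_smul]
    exact Submodule.zero_mem _

/-- The cones of `fanPrime` cover the images of the nonnegative vectors. -/
theorem exists_fanPrime_mem (hI : ∀ j, Nonempty (I j)) (y : (Σ j, I j) → ℝ) :
    ∃ τ ∈ fanPrime I, proj I y ∈ τ := by
  classical
  have hmin : ∀ j, ∃ i : I j, ∀ k : I j, y ⟨j, i⟩ ≤ y ⟨j, k⟩ := fun j => by
    obtain ⟨i, -, hi⟩ := Finset.exists_min_image Finset.univ (fun k : I j => y ⟨j, k⟩)
      ⟨(hI j).some, Finset.mem_univ _⟩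
    exact ⟨i, fun k => hi k (Finset.mem_univ _)⟩
  choose i hi using hmin
  -- Subtracting the minimum of each block makes the vector nonnegative; K omits one minimising
  -- index per block.
  refine ⟨_, ⟨{k | k.2 ≠ i k.1}, fun j => ⟨i j, by simp⟩, rfl⟩, ?_⟩
  have h : proj I y = proj I (fun k => y k - y ⟨k.1, i k.1⟩) :=
    (proj_eq_proj_iff _ _).2 ⟨fun j => y ⟨j, i j⟩, fun k => by ring⟩
  rw [h]
  refine proj_mem_hull_of_support (fun k => ?_) (fun k hk => ?_)
  · have := hi k.1 k.2
    linarith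
  · simp only [Set.mem_ofPred_eq, not_not] at hk
    rw [← hk]
    simp

theorem nonempty_block (D : GreenePlesserData I) (j : Fin r) : Nonempty (I j) :=
  Fintype.card_pos_iff.1 (by have := D.three_le_card j; omega)

/-! ### Conic combinations of the vectors of Ξ_0 and the value of ψ_λ -/

variable (D : GreenePlesserData I)

theorem Xi0_nonneg (p : D.Xi0) (i : Σ j, I j) : (0 : ℝ) ≤ ((p : (Σ j, I j) → ℤ) i : ℝ) :=
  p.2.1.2.1 i

theorem Xi0_pair (p : D.Xi0) :
    ∑ i, D.nSigma i * ((p : (Σ j, I j) → ℤ) i : ℝ) = 1 := p.2.1.2.2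

theorem Xi0_exists_zero (p : D.Xi0) (j : Fin r) :
    ∃ i : I j, ((p : (Σ j, I j) → ℤ) ⟨j, i⟩ : ℝ) = 0 := by
  have h := p.2.2 j
  obtain ⟨i, hi⟩ := Finset.card_pos.1 (lt_of_lt_of_le two_pos h)
  exact ⟨i, by simpa using hi⟩

theorem sum_smul_projXi (t : D.Xi0 → ℝ) :
    ∑ p, t p • D.projXi p =
      proj I (fun i => ∑ p : D.Xi0, t p * ((p : (Σ j, I j) → ℤ) i : ℝ)) := by
  simp only [projXi, ← map_smul, ← map_sum]
  congr 1
  funext i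
  simp [Finset.sum_apply]

/-- The nonnegative combinations of the `π p` that represent `x`. -/
def conicReps (x : MTilde I) : Set (D.Xi0 → ℝ) :=
  {t | (∀ p, 0 ≤ t p) ∧ ∑ p, t p • D.projXi p = x}

theorem conicReps_nonempty (x : MTilde I) : (D.conicReps x).Nonempty := by
  classical
  obtain ⟨y, rfl⟩ := Submodule.mkQ_surjective _ x
  obtain ⟨_, ⟨K, hK, rfl⟩, hy⟩ := exists_fanPrime_mem D.nonempty_block y
  obtain ⟨a, ha, -, hay⟩ := mem_hull_proj_image hy
  let e : (Σ j, I j) → D.Xi0 := fun i => ⟨Pi.single i (D.d i : ℤ), D.single_mem_Xi0 i⟩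
  have hd : ∀ i, (0 : ℝ) < D.d i := fun i => by exact_mod_cast D.d_pos i
  refine ⟨∑ i, Pi.single (e i) (a i / D.d i), fun p => ?_, ?_⟩
  · rw [Finset.sum_apply]
    refine Finset.sum_nonneg fun i _ => ?_
    have := div_nonneg (ha i) (hd i).le
    rw [Pi.single_apply]
    split_ifs <;> simp [this]
  · rw [sum_smul_projXi, ← proj, ← hay]
    congr 1
    funext k
    simp only [Finset.sum_apply, Finset.sum_mul]
    rw [Finset.sum_comm, Finset.sum_eq_single k]
    · rw [Finset.sum_eq_single (e k)]
      · have := (hd k).ne'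
        simp [e]
        field_simp
      · intro p _ hp; simp [hp]
      · simp
    · intro i _ hik
      rw [Finset.sum_eq_single (e i)]
      · simp [e, Pi.single_eq_of_ne (Ne.symm hik)]
      · intro p _ hp; simp [hp]
      · simp
    · simp

/-- Since every λ_p is positive, a bound on the cost bounds each coefficient, so the sublevel sets
of the cost are compact. -/
theorem exists_min_conicReps (lam : D.Xi0 → ℝ) (hlam : ∀ p, 0 < lam p) (x : MTilde I) :
    ∃ t ∈ D.conicReps x, ∀ t' ∈ D.conicReps x, ∑ p, t p * lam p ≤ ∑ p, t' p * lam p := by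
  classical
  obtain ⟨t0, ht0⟩ := D.conicReps_nonempty x
  set C := ∑ p, t0 p * lam p with hC
  have hcost : Continuous fun t : D.Xi0 → ℝ => ∑ p, t p * lam p := by fun_prop
  have hclosed : IsClosed (D.conicReps x) := by
    obtain ⟨y, rfl⟩ := Submodule.mkQ_surjective _ x
    have h1 : D.conicReps (Submodule.mkQ _ y) = {t | ∀ p, 0 ≤ t p} ∩
        (fun t : D.Xi0 → ℝ =>
          (fun i => ∑ p : D.Xi0, t p * ((p : (Σ j, I j) → ℤ) i : ℝ)) - y) ⁻¹'
        (Submodule.span ℝ (Set.range (blockR I)) : Set ((Σ j, I j) → ℝ)) := by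
      ext t
      simp only [conicReps, Set.mem_ofPred_eq, Set.mem_inter_iff, Set.mem_preimage, SetLike.mem_coe]
      rw [sum_smul_projXi, proj, ← sub_eq_zero, ← map_sub, Submodule.mkQ_apply,
        Submodule.Quotient.mk_eq_zero]
    rw [h1]
    refine IsClosed.inter ?_ ?_
    · rw [Set.ofPred_forall]
      exact isClosed_iInter fun p => isClosed_le continuous_const (continuous_apply p)
    · refine (Submodule.closed_of_finiteDimensional _).preimage ?_
      fun_prop
  have hcomp : IsCompact (D.conicReps x ∩ {t | ∑ p, t p * lam p ≤ C}) := by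
    refine (isCompact_Icc (a := (0 : D.Xi0 → ℝ)) (b := fun p => C / lam p)).of_isClosed_subset
      (hclosed.inter (isClosed_le hcost continuous_const)) ?_
    rintro t ⟨⟨ht, -⟩, htC⟩
    refine ⟨ht, fun p => ?_⟩
    rw [le_div_iff₀ (hlam p)]
    exact (Finset.single_le_sum (f := fun p => t p * lam p)
      (fun p _ => mul_nonneg (ht p) (hlam p).le) (Finset.mem_univ p)).trans htC
  obtain ⟨t, ⟨ht, htC⟩, hmin⟩ := hcomp.exists_isMinOn ⟨t0, ht0, le_refl C⟩ hcost.continuousOn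
  refine ⟨t, ht, fun t' ht' => ?_⟩
  by_cases h : ∑ p, t' p * lam p ≤ C
  · exact hmin ⟨ht', h⟩
  · exact le_trans htC (not_le.1 h).le

/-- The value of `psi` at `x` is attained by a nonnegative combination representing `x`. -/
theorem exists_conicReps_psi_le (lam : D.Xi0 → ℝ) (hlam : ∀ p, 0 < lam p) (x : MTilde I) :
    ∃ t ∈ D.conicReps x, D.psi lam x ≤ -∑ p, t p * lam p := by
  classical
  choose T hT hmin using D.exists_min_conicReps lam hlam
  refine ⟨T x, hT x, ?_⟩
  -- The minimal cost is subadditive and positively homogeneous, so its negative is a concave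
  -- candidate, and ψ_λ lies below every candidate.
  suffices hcand : (fun x => -∑ p, T x p * lam p) ∈ D.supportCandidates lam from
    (D.isLeast_psi lam fun p => (hlam p).le).2 hcand x
  refine ⟨⟨convex_univ, fun x _ y _ a b ha hb hab => ?_⟩, ?_⟩
  · have h := hmin (a • x + b • y) (a • T x + b • T y) ⟨fun p =>
      add_nonneg (mul_nonneg ha ((hT x).1 p)) (mul_nonneg hb ((hT y).1 p)), ?_⟩
    · simp only [Pi.add_apply, Pi.smul_apply, smul_eq_mul, add_mul, Finset.sum_add_distrib,
        mul_assoc, ← Finset.mul_sum] at h ⊢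
      linarith
    · simp only [Pi.add_apply, Pi.smul_apply, add_smul, Finset.sum_add_distrib, smul_assoc,
        ← Finset.smul_sum, (hT x).2, (hT y).2]
  · intro p t ht
    have h := hmin (t • D.projXi p) (Pi.single p t) ⟨fun k => ?_, ?_⟩
    · have h1 : ∑ k, (Pi.single p t : D.Xi0 → ℝ) k * lam k = t * lam p := by
        rw [Finset.sum_eq_single p (fun k _ hk => by simp [hk]) (by simp), Pi.single_eq_same]
      linarith
    · rw [Pi.single_apply]; split_ifs <;> simp [ht]
    · rw [Finset.sum_eq_single p (fun k _ hk => by simp [hk]) (by simp)]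
      simp

theorem neg_lam_le_psi (lam : D.Xi0 → ℝ) (hlam : ∀ p, 0 < lam p) (p : D.Xi0) :
    -lam p ≤ D.psi lam (D.projXi p) := by
  have h := (D.isLeast_psi lam fun p => (hlam p).le).1.2 p 1 zero_le_one
  simpa using h

/-! ### Rays of the fan and linear independence of tight vectors -/

/-- Both lifts are nonnegative with a zero in each block, which excludes a nonzero block
translation; pairing with n_σ then forces c = 1. -/
theorem eq_of_projXi_eq_smul {p p' : D.Xi0} {c : ℝ} (hc : 0 ≤ c)
    (h : D.projXi p = c • D.projXi p') : p = p' := by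
  rw [projXi, projXi, ← map_smul, proj_eq_proj_iff] at h
  obtain ⟨s, hs⟩ := h
  have hs0 : ∀ j, s j = 0 := fun j => by
    obtain ⟨k, hk⟩ := D.Xi0_exists_zero p j
    obtain ⟨k', hk'⟩ := D.Xi0_exists_zero p' j
    have h1 := hs ⟨j, k⟩
    have h2 := hs ⟨j, k'⟩
    have h3 := mul_nonneg hc (D.Xi0_nonneg p' ⟨j, k⟩)
    have h4 := D.Xi0_nonneg p ⟨j, k'⟩
    simp only [Pi.smul_apply, smul_eq_mul, hk, hk'] at h1 h2
    linarith
  have hpp : ∀ i, ((p : (Σ j, I j) → ℤ) i : ℝ) = c * ((p' : (Σ j, I j) → ℤ) i : ℝ) := fun i => by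
    have := hs i
    rwa [hs0, add_zero] at this
  have hc1 : c = 1 := by
    have h1 := D.Xi0_pair p
    simp only [hpp] at h1
    rw [← D.Xi0_pair p', ← mul_one c, ← D.Xi0_pair p', Finset.mul_sum, D.Xi0_pair p', ← h1]
    exact Finset.sum_congr rfl fun i _ => by ring
  refine Subtype.ext (funext fun i => ?_)
  have := hpp i
  rw [hc1, one_mul] at this
  exact_mod_cast this

theorem projXi_ne_zero (p : D.Xi0) : D.projXi p ≠ 0 := by
  intro h
  have h0 : D.projXi p = proj I 0 := by rw [h, map_zero]
  obtain ⟨s, hs⟩ := (proj_eq_proj_iff _ _).1 h0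
  have h1 := D.Xi0_pair p
  rw [Finset.sum_eq_zero] at h1
  · exact zero_ne_one h1
  · intro i _
    obtain ⟨k, hk⟩ := D.Xi0_exists_zero p i.1
    have h2 := hs ⟨i.1, k⟩
    have h3 := hs i
    rw [hk] at h2
    simp only [Pi.zero_apply, zero_add] at h2 h3
    rw [h3, ← h2, mul_zero]

/-- A vector of a simplicial cone of a fan of domains of linearity that generates a ray of the fan
is a positive multiple of a generator of the cone. -/
theorem exists_generator_of_ray {E : Type*} [AddCommGroup E] [Module ℝ E] {ψ : E → ℝ}
    {τ ρ : PointedCone ℝ E} (hτ : τ ∈ linearityFan ψ) (hρ : ρ ∈ linearityFan ψ) {s : Set E}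
    (hs : s.Finite) (hsτ : τ = PointedCone.hull ℝ s) {v : E} (hv : v ≠ 0)
    (hvρ : ρ = PointedCone.hull ℝ {v}) (hvτ : v ∈ τ) : ∃ u ∈ s, ∃ c : ℝ, 0 < c ∧ v = c • u := by
  classical
  obtain ⟨m, hm, hmτ⟩ := hτ
  obtain ⟨n, hn, hnρ⟩ := hρ
  lift s to Finset E using hs
  rw [hsτ] at hvτ
  obtain ⟨a, -, hav⟩ := Submodule.mem_span_finset.1 hvτ
  obtain ⟨u, hu, hau⟩ : ∃ u ∈ s, a u • u ≠ 0 := by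
    by_contra! hcon
    exact hv (hav.symm.trans (Finset.sum_eq_zero hcon))
  have hmem : ∀ w ∈ s, a w • w ∈ τ := fun w hw => by
    rw [hsτ]
    exact Submodule.smul_mem _ _ (Submodule.subset_span hw)
  have hvm : ψ v = ∑ w ∈ s, ψ (a w • w) := by
    have h1 : v ∈ τ := hsτ ▸ hvτ
    rw [(hmτ v).1 h1, ← hav, map_sum]
    exact Finset.sum_congr rfl fun w hw => ((hmτ _).1 (hmem w hw)).symm
  have hvn : ψ v = ∑ w ∈ s, n (a w • w) := by
    have h1 : v ∈ ρ := by rw [hvρ]; exact Submodule.subset_span rfl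
    rw [(hnρ v).1 h1, ← map_sum, hav]
  -- Both sums equal ψ v, and n dominates ψ termwise, so all terms agree. Hence a u • u lies on the
  -- ray ρ through v.
  have hun : ψ (a u • u) = n (a u • u) :=
    (Finset.sum_eq_sum_iff_of_le fun w _ => hn (a w • w)).1 (hvm.symm.trans hvn) u hu
  have huρ := (hnρ _).2 hun
  rw [hvρ] at huρ
  obtain ⟨c, hc⟩ := Submodule.mem_span_singleton.1 huρ
  have hc' : (c : ℝ) • v = (a u : ℝ) • u := hc
  have hc0 : (c : ℝ) ≠ 0 := fun h0 => by
    rw [h0, zero_smul] at hc'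
    exact hau hc'.symm
  have ha0 : (a u : ℝ) ≠ 0 := fun h0 => by
    apply hau
    change (a u : ℝ) • u = 0
    rw [h0, zero_smul]
  have hc1 : 0 < (c : ℝ) := lt_of_le_of_ne c.2 hc0.symm
  have ha1 : 0 < (a u : ℝ) := lt_of_le_of_ne (a u).2 ha0.symm
  refine ⟨u, hu, (a u : ℝ) / c, div_pos ha1 hc1, ?_⟩
  rw [div_eq_inv_mul, mul_smul, ← hc', smul_smul, inv_mul_cancel₀ hc0, one_smul]

/-- If a linear functional is at least `-lam p` on each `p` and nonnegative on each block, then the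
projections of the `p` at which it is exactly `-lam p` are linearly independent. -/
theorem linearIndependent_projXi_of_tight (lam : D.Xi0 → ℝ) (hlam : ∀ p, 0 < lam p)
    (hMPCP : D.MPCP lam) (v : (Σ j, I j) → ℝ)
    (hv : ∀ p : D.Xi0, -lam p ≤ ∑ i, v i * ((p : (Σ j, I j) → ℤ) i : ℝ))
    (hvb : ∀ j, 0 ≤ ∑ i : I j, v ⟨j, i⟩) :
    LinearIndependent ℝ (fun p : {p : D.Xi0 //
      ∑ i, v i * ((p : (Σ j, I j) → ℤ) i : ℝ) = -lam p} => D.projXi p) := by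
  classical
  obtain ⟨-, hsimp, ⟨hsupp, href⟩, hrays⟩ := hMPCP
  set P : Finset D.Xi0 := Finset.univ.filter fun p : D.Xi0 =>
    ∑ i, v i * ((p : (Σ j, I j) → ℤ) i : ℝ) = -lam p with hP
  -- Summing all tight vectors lets a single cone τ containing π(y) capture all of them at once.
  set y : (Σ j, I j) → ℝ := fun i => ∑ p ∈ P, ((p : (Σ j, I j) → ℤ) i : ℝ) with hy
  have hyproj : proj I y = ∑ p ∈ P, D.projXi p := by
    simp only [projXi, ← map_sum]
    congr 1
    funext i
    simp [hy, Finset.sum_apply]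
  obtain ⟨τ, hτ, hyτ⟩ : ∃ τ ∈ D.fanLam lam, proj I y ∈ τ := by
    obtain ⟨τ', hτ', hyτ'⟩ := exists_fanPrime_mem D.nonempty_block y
    have : proj I y ∈ ⋃ τ ∈ fanPrime I, (τ : Set (MTilde I)) :=
      Set.mem_biUnion hτ' hyτ'
    rw [← hsupp] at this
    simpa using this
  obtain ⟨_, ⟨K, hK, rfl⟩, hττ'⟩ := href τ hτ
  obtain ⟨m, hm, hmτ⟩ := id hτ
  have hpsi := D.neg_lam_le_psi lam hlam
  have hmp : ∀ p, -lam p ≤ m (D.projXi p) := fun p => (hpsi p).trans (hm _)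
  have htight : ∀ p, m (D.projXi p) = -lam p → D.projXi p ∈ τ := fun p hp =>
    (hmτ _).2 (le_antisymm (hm _) (hp ▸ hpsi p))
  obtain ⟨t, ⟨ht, hty⟩, htpsi⟩ := D.exists_conicReps_psi_le lam hlam (proj I y)
  -- the optimal representation only uses vectors of `τ`
  have htm : ∀ p, t p ≠ 0 → m (D.projXi p) = -lam p := by
    have h1 : ∑ p, t p * (m (D.projXi p) + lam p) ≤ 0 := by
      have h2 : m (proj I y) = ∑ p, t p * m (D.projXi p) := by
        rw [← hty, map_sum]; simp
      rw [(hmτ _).1 hyτ, h2] at htpsi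
      simp only [mul_add, Finset.sum_add_distrib]
      linarith
    have h3 : ∀ p ∈ Finset.univ, 0 ≤ t p * (m (D.projXi p) + lam p) := fun p _ =>
      mul_nonneg (ht p) (by have := hmp p; linarith)
    have h4 := (Finset.sum_eq_zero_iff_of_nonneg h3).1 (le_antisymm h1 (Finset.sum_nonneg h3))
    intro p hp
    rcases mul_eq_zero.1 (h4 p (Finset.mem_univ p)) with h | h
    · exact absurd h hp
    · linarith
  rw [sum_smul_projXi] at hty
  obtain ⟨s, hs⟩ := (proj_eq_proj_iff _ _).1 hty.symm
  -- At an index k of block j outside K, every p used in the representation vanishes, so s j is the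
  -- coordinate of y there.
  have hs0 : ∀ j, 0 ≤ s j := fun j => by
    obtain ⟨k, hk⟩ := hK j
    have h1 := hs ⟨j, k⟩
    rw [Finset.sum_eq_zero, zero_add] at h1
    · rw [← h1]
      exact Finset.sum_nonneg fun p _ => D.Xi0_nonneg p _
    · intro p _
      by_cases hp : t p = 0
      · rw [hp, zero_mul]
      · rw [eq_zero_of_proj_mem_hull (D.Xi0_nonneg p) (D.Xi0_exists_zero p)
          (hττ' (htight p (htm p hp))) hk, mul_zero]
  have hvy : D.psi lam (proj I y) ≤ ∑ i, v i * y i := by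
    refine htpsi.trans ?_
    have h1 : ∑ i, v i * y i = ∑ p : D.Xi0, t p * ∑ i, v i * ((p : (Σ j, I j) → ℤ) i : ℝ) +
        ∑ j, s j * ∑ i : I j, v ⟨j, i⟩ := by
      simp only [hs, mul_add, Finset.sum_add_distrib, Finset.mul_sum]
      congr 1
      · rw [Finset.sum_comm]
        exact Finset.sum_congr rfl fun _ _ => Finset.sum_congr rfl fun _ _ => by ring
      · rw [Fintype.sum_sigma]
        exact Finset.sum_congr rfl fun _ _ => Finset.sum_congr rfl fun _ _ => by ring
    rw [h1, ← Finset.sum_neg_distrib]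
    refine le_add_of_le_of_nonneg (Finset.sum_le_sum fun p _ => ?_)
      (Finset.sum_nonneg fun j _ => mul_nonneg (hs0 j) (hvb j))
    rw [← mul_neg]
    exact mul_le_mul_of_nonneg_left (hv p) (ht p)
  -- The bound just obtained says that the sum of m(π(p)) over P is at most that of -λ_p, while each
  -- term satisfies the opposite inequality.
  have hPtau : ∀ p ∈ P, m (D.projXi p) = -lam p := by
    have h1 : ∑ i, v i * y i = ∑ p ∈ P, -lam p := by
      simp only [hy, Finset.mul_sum]
      rw [Finset.sum_comm]
      exact Finset.sum_congr rfl fun p hp => (Finset.mem_filter.1 hp).2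
    rw [(hmτ _).1 hyτ, h1, hyproj, map_sum] at hvy
    have h2 := (Finset.sum_eq_sum_iff_of_le fun p _ => hmp p).1
      (le_antisymm (Finset.sum_le_sum fun p _ => hmp p) hvy)
    exact fun p hp => (h2 p hp).symm
  obtain ⟨S, hS, hSlin, hSτ⟩ := hsimp τ hτ
  have hgen : ∀ p : {p : D.Xi0 // ∑ i, v i * ((p : (Σ j, I j) → ℤ) i : ℝ) = -lam p},
      ∃ u ∈ S, ∃ c : ℝ, 0 < c ∧ D.projXi p = c • u := fun p => by
    have hρ : PointedCone.hull ℝ {D.projXi p} ∈ fanRays (D.fanLam lam) := by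
      rw [hrays]; exact ⟨p.1, rfl⟩
    exact exists_generator_of_ray hτ hρ.1 hS hSτ (D.projXi_ne_zero p) rfl
      (htight p (hPtau p (Finset.mem_filter.2 ⟨Finset.mem_univ _, p.2⟩)))
  choose u hu c hc hpu using hgen
  -- Two p with the same generator would have proportional projections, hence be equal.
  have hinj : Function.Injective fun p => (⟨u p, hu p⟩ : S) := by
    intro p p' hpp
    have huu : u p = u p' := congrArg Subtype.val hpp
    refine Subtype.ext (D.eq_of_projXi_eq_smul (c := c p / c p') (div_pos (hc p) (hc p')).le ?_)
    rw [hpu p, hpu p', smul_smul, div_mul_cancel₀ _ (hc p').ne', huu]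
  have hlin := (LinearIndependent.comp hSlin _ hinj).units_smul
    (fun p => Units.mk0 (c p) (hc p).ne')
  have heq : (fun p : {p : D.Xi0 // ∑ i, v i * ((p : (Σ j, I j) → ℤ) i : ℝ) = -lam p} =>
      D.projXi p) = fun p => c p • u p := funext hpu
  rw [heq]
  exact hlin

end GreenePlesserData

/-! ### Monomials of the potential: orders, Euler relations and criticality of the origin -/

/-- A vanishing factor is harmless when its exponent is 0: it contributes 0 ^ 0 = 1 to the product
and 0 to the sum. -/
theorem HahnSeries.prod_pow_ne_zero_and_order {ι : Type*} (s : Finset ι)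
    (x : ι → HahnSeries ℝ ℂ) (e : ι → ℕ) (h : ∀ i ∈ s, x i = 0 → e i = 0) :
    ∏ i ∈ s, x i ^ e i ≠ 0 ∧ (∏ i ∈ s, x i ^ e i).order = ∑ i ∈ s, (x i).order * e i := by
  classical
  induction s using Finset.induction_on with
  | empty => simp
  | insert a s ha ih =>
    obtain ⟨h1, h2⟩ := ih fun i hi => h i (Finset.mem_insert_of_mem hi)
    have h3 : x a ^ e a ≠ 0 := by
      by_cases hx : x a = 0
      · rw [h a (Finset.mem_insert_self a s) hx, pow_zero]; exact one_ne_zero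
      · exact pow_ne_zero _ hx
    rw [Finset.prod_insert ha, Finset.sum_insert ha]
    refine ⟨mul_ne_zero h3 h1, ?_⟩
    rw [HahnSeries.order_mul h3 h1, HahnSeries.order_pow, h2, nsmul_eq_mul, mul_comm (e a : ℝ)]

namespace GreenePlesserData

variable {r : ℕ} {I : Fin r → Type*} [∀ j, Fintype (I j)]

theorem sum_mul_block (v : (Σ j, I j) → ℝ) (j : Fin r) :
    ∑ i, v i * (blockZ I j i : ℝ) = ∑ i : I j, v ⟨j, i⟩ := by
  rw [Fintype.sum_sigma, Finset.sum_eq_single j]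
  · simp [blockZ]
  · intro j' _ hj
    simp [blockZ, hj]
  · simp

theorem eval_zMonomial (v : (Σ j, I j) → ℤ) (c : Novikov) (z : (Σ j, I j) → Novikov) :
    MvPolynomial.eval z (zMonomial v c) = c * ∏ i, z i ^ (v i).toNat := by
  rw [zMonomial, MvPolynomial.eval_monomial, Finsupp.prod_fintype _ _ (by simp)]
  simp

theorem mul_eval_pderiv_zMonomial (v : (Σ j, I j) → ℤ) (c : Novikov) (z : (Σ j, I j) → Novikov)
    (i : Σ j, I j) :
    z i * MvPolynomial.eval z (MvPolynomial.pderiv i (zMonomial v c)) =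
      (v i).toNat • MvPolynomial.eval z (zMonomial v c) := by
  have h := congrArg (MvPolynomial.eval z) (MvPolynomial.X_mul_pderiv_monomial (i := i)
    (m := Finsupp.equivFunOnFinite.symm fun i => (v i).toNat) (r := c))
  rw [map_mul, MvPolynomial.eval_X, map_nsmul] at h
  exact h

variable [∀ j, DecidableEq (I j)] (D : GreenePlesserData I)

/-- The exponent vectors of the monomials of `W`. -/
def expo : Fin r ⊕ D.Xi0 → (Σ j, I j) → ℤ := Sum.elim (blockZ I) Subtype.val

/-- The coefficients of the monomials of `W`. -/
noncomputable def coef (b : D.Xi0 → Novikov) : Fin r ⊕ D.Xi0 → Novikov :=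
  Sum.elim (fun _ => -1) b

/-- The valuations of the coefficients of `W`. -/
def coefVal (lam : D.Xi0 → ℝ) : Fin r ⊕ D.Xi0 → ℝ := Sum.elim (fun _ => 0) lam

theorem W_eq_sum (b : D.Xi0 → Novikov) :
    D.W b = ∑ m, zMonomial (D.expo m) (D.coef b m) := by
  rw [W, Fintype.sum_sum_type, ← Finset.sum_neg_distrib]
  simp [expo, coef, zMonomial]

theorem expo_nonneg (m : Fin r ⊕ D.Xi0) (i : Σ j, I j) : 0 ≤ D.expo m i := by
  rcases m with j | p
  · simp only [expo, Sum.elim_inl, blockZ]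
    split_ifs <;> simp
  · exact_mod_cast D.Xi0_nonneg p i

theorem cast_toNat_expo (R : Type*) [AddGroupWithOne R] (m : Fin r ⊕ D.Xi0) (i : Σ j, I j) :
    ((D.expo m i).toNat : R) = (D.expo m i : R) := by
  rw [← Int.cast_natCast, Int.toNat_of_nonneg (D.expo_nonneg m i)]

theorem sum_nSigma_block (j : Fin r) : ∑ i : I j, D.nSigma ⟨j, i⟩ = 1 := by
  have h := congrArg (Rat.cast : ℚ → ℝ) (D.sum_inv_d j)
  push_cast at h
  simpa only [nSigma_eq] using h

/-- This is the weighted homogeneity of the potential: every monomial has weight 1. -/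
theorem expo_pair (m : Fin r ⊕ D.Xi0) : ∑ i, D.nSigma i * (D.expo m i : ℝ) = 1 := by
  rcases m with j | p
  · exact (sum_mul_block _ j).trans (D.sum_nSigma_block j)
  · exact D.Xi0_pair p

theorem nSigma_pos (i : Σ j, I j) : 0 < D.nSigma i := by
  have : (0 : ℝ) < D.d i := by exact_mod_cast D.d_pos i
  rw [nSigma_eq]
  positivity

theorem nSigma_lt_one (i : Σ j, I j) : D.nSigma i < 1 := by
  obtain ⟨j, k⟩ := i
  have hcard := D.three_le_card j
  obtain ⟨k', hk'⟩ := Fintype.exists_ne_of_one_lt_card (by omega) k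
  rw [← D.sum_nSigma_block j]
  exact Finset.single_lt_sum (f := fun k => D.nSigma ⟨j, k⟩) hk' (Finset.mem_univ _)
    (Finset.mem_univ _) (D.nSigma_pos _) fun k _ _ => (D.nSigma_pos _).le

theorem coef_ne_zero_and_order {lam : D.Xi0 → ℝ} {b : D.Xi0 → Novikov}
    (hb : ∀ p, Novikov.val (b p) = (lam p : WithTop ℝ)) (m : Fin r ⊕ D.Xi0) :
    (D.coef b m : HahnSeries ℝ ℂ) ≠ 0 ∧
      (D.coef b m : HahnSeries ℝ ℂ).order = D.coefVal lam m := by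
  rcases m with j | p
  · simp [coef, coefVal]
  · have h := hb p
    have h0 : (b p : HahnSeries ℝ ℂ) ≠ 0 := fun h0 => by
      rw [Novikov.val, h0, HahnSeries.orderTop_zero] at h
      exact WithTop.top_ne_coe h
    refine ⟨h0, ?_⟩
    rw [Novikov.val, ← HahnSeries.order_eq_orderTop_of_ne_zero h0] at h
    exact WithTop.coe_injective h

theorem eval_zero_W (b : D.Xi0 → Novikov) : MvPolynomial.eval 0 (D.W b) = 0 := by
  rw [W_eq_sum, map_sum]
  refine Finset.sum_eq_zero fun m _ => ?_
  rw [eval_zMonomial]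
  obtain ⟨i, -, hi⟩ := Finset.exists_ne_zero_of_sum_ne_zero
    (s := Finset.univ) (f := fun i => D.nSigma i * (D.expo m i : ℝ))
    (by rw [D.expo_pair m]; exact one_ne_zero)
  have h1 : D.expo m i ≠ 0 := fun h => hi (by simp [h])
  have h2 := D.expo_nonneg m i
  rw [Finset.prod_eq_zero (Finset.mem_univ i), mul_zero]
  exact zero_pow (by omega)

/-- No monomial is linear: e_i has weight n_σ(i) < 1, while every exponent has weight 1. So each
nonzero derivative term keeps a positive power of some coordinate. -/
theorem zero_mem_criticalLocus_W (b : D.Xi0 → Novikov) :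
    (0 : (Σ j, I j) → Novikov) ∈ criticalLocus (D.W b) := by
  classical
  intro i
  rw [W_eq_sum, map_sum, map_sum]
  refine Finset.sum_eq_zero fun m _ => ?_
  rw [zMonomial, MvPolynomial.pderiv_monomial, MvPolynomial.eval_monomial,
    Finsupp.prod_fintype _ _ (by simp)]
  by_cases hi : D.expo m i = 0
  · simp [hi]
  have hi0 := D.expo_nonneg m i
  obtain ⟨k, hk⟩ : ∃ k, (if k = i then 1 else 0) < D.expo m k := by
    by_contra! hcon
    have h1 : D.expo m i = 1 := by
      have := hcon i
      rw [if_pos rfl] at this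
      omega
    have h2 := D.expo_pair m
    rw [Finset.sum_eq_single i, h1, Int.cast_one, mul_one] at h2
    · exact (D.nSigma_lt_one i).ne h2
    · intro k _ hki
      have h3 := hcon k
      rw [if_neg hki] at h3
      rw [le_antisymm h3 (D.expo_nonneg m k), Int.cast_zero, mul_zero]
    · simp
  rw [Finset.prod_eq_zero (Finset.mem_univ k), mul_zero]
  refine zero_pow ?_
  simp only [Finsupp.tsub_apply, Finsupp.equivFunOnFinite_symm_apply_apply, Finsupp.single_apply]
  by_cases hki : i = k
  · rw [if_pos hki.symm] at hk
    rw [if_pos hki]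
    omega
  · rw [if_neg (Ne.symm hki)] at hk
    rw [if_neg hki]
    omega

/-! ### The tropical argument -/

/-- The exponents of the monomials at which the tropical polynomial attains its minimum are
linearly independent. -/
theorem eq_zero_of_sum_mul_expo_eq_zero (lam : D.Xi0 → ℝ) (hlam : ∀ p, 0 < lam p)
    (hMPCP : D.MPCP lam) (v : (Σ j, I j) → ℝ) (μ : ℝ)
    (hv : ∀ m, μ ≤ D.coefVal lam m + ∑ i, v i * (D.expo m i : ℝ)) (c : Fin r ⊕ D.Xi0 → ℝ)
    (hc : ∀ m, c m ≠ 0 → D.coefVal lam m + ∑ i, v i * (D.expo m i : ℝ) = μ)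
    (hsum : ∀ i, ∑ m, c m * (D.expo m i : ℝ) = 0) (m : Fin r ⊕ D.Xi0) : c m = 0 := by
  classical
  -- As every exponent has weight 1, this shift moves the tropical minimum from μ to 0.
  set w : (Σ j, I j) → ℝ := fun i => v i - μ * D.nSigma i with hw
  have hpair : ∀ m, ∑ i, w i * (D.expo m i : ℝ) = ∑ i, v i * (D.expo m i : ℝ) - μ := fun m => by
    simp only [hw, sub_mul, Finset.sum_sub_distrib, mul_assoc, ← Finset.mul_sum, D.expo_pair,
      mul_one]
  have hlin := D.linearIndependent_projXi_of_tight lam hlam hMPCP w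
    (fun p => by
      have h1 := hv (Sum.inr p)
      have h2 := hpair (Sum.inr p)
      simp only [expo, coefVal, Sum.elim_inr] at h1 h2
      linarith)
    (fun j => by
      have h1 := hv (Sum.inl j)
      have h2 := hpair (Sum.inl j)
      simp only [expo, coefVal, Sum.elim_inl] at h1 h2
      rw [sum_mul_block] at h2
      linarith)
  have htight : ∀ p : D.Xi0, c (Sum.inr p) ≠ 0 →
      ∑ i, w i * ((p : (Σ j, I j) → ℤ) i : ℝ) = -lam p := fun p hp => by
    have h1 := hc _ hp
    have h2 := hpair (Sum.inr p)
    simp only [expo, coefVal, Sum.elim_inr] at h1 h2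
    linarith
  simp only [Fintype.sum_sum_type, expo, Sum.elim_inl, Sum.elim_inr] at hsum
  have hblock : ∀ i : Σ j, I j, ∑ j, c (Sum.inl j) * (blockZ I j i : ℝ) = c (Sum.inl i.1) :=
    fun i => by simp [blockZ]
  simp only [hblock] at hsum
  -- The projection kills the block vectors, leaving a relation between the π(p) alone.
  have hproj : ∑ p, c (Sum.inr p) • D.projXi p = 0 := by
    rw [sum_smul_projXi, ← map_zero (proj I), proj_eq_proj_iff]
    refine ⟨fun j => -c (Sum.inl j), fun i => ?_⟩
    have := hsum i
    simp only [Pi.zero_apply]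
    linarith
  have hp0 : ∀ p, c (Sum.inr p) = 0 := by
    rw [← Finset.sum_filter_add_sum_filter_not Finset.univ (fun p : D.Xi0 =>
      ∑ i, w i * ((p : (Σ j, I j) → ℤ) i : ℝ) = -lam p), Finset.sum_eq_zero (s := Finset.filter
      (fun p : D.Xi0 => ¬ _) _), add_zero, Finset.sum_subtype _ (p := fun p : D.Xi0 =>
      ∑ i, w i * ((p : (Σ j, I j) → ℤ) i : ℝ) = -lam p) (by simp)] at hproj
    · intro p
      by_contra hp
      exact hp (Fintype.linearIndependent_iff.1 hlin (fun p => c (Sum.inr p.1)) hproj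
        ⟨p, htight p hp⟩)
    · intro p hp
      have h1 : c (Sum.inr p) = 0 := by
        by_contra h
        exact (Finset.mem_filter.1 hp).2 (htight p h)
      rw [h1, zero_smul]
  rcases m with j | p
  · obtain ⟨k⟩ := nonempty_block D j
    simpa [hp0] using hsum ⟨j, k⟩
  · exact hp0 p

/-- The lowest-order part of the Euler relations at a nonzero critical point would be a nontrivial
relation between tropically minimal exponents. -/
theorem eq_zero_of_mem_criticalLocus_W (lam : D.Xi0 → ℝ) (hlam : ∀ p, 0 < lam p)
    (hMPCP : D.MPCP lam) (b : D.Xi0 → Novikov)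
    (hb : ∀ p, Novikov.val (b p) = (lam p : WithTop ℝ)) (z : (Σ j, I j) → Novikov)
    (hz : z ∈ criticalLocus (D.W b)) : z = 0 := by
  classical
  by_contra hz0
  obtain ⟨i0, hi0⟩ := Function.ne_iff.1 hz0
  set x : (Σ j, I j) → HahnSeries ℝ ℂ := fun i => z i with hx
  have hxz : ∀ i, x i = 0 ↔ z i = 0 := fun i => by simp [hx]
  set T : Fin r ⊕ D.Xi0 → HahnSeries ℝ ℂ := fun m =>
    (D.coef b m : HahnSeries ℝ ℂ) * ∏ i, x i ^ (D.expo m i).toNat with hT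
  have heuler : ∀ i, ∑ m, (D.expo m i).toNat • T m = 0 := fun i => by
    have h1 : ∑ m, (D.expo m i).toNat •
        MvPolynomial.eval z (zMonomial (D.expo m) (D.coef b m)) = 0 := by
      simp only [← mul_eval_pderiv_zMonomial, ← Finset.mul_sum, ← map_sum, ← W_eq_sum]
      rw [hz i, mul_zero]
    have h2 := congrArg novikovSubfield.subtype h1
    simpa [eval_zMonomial, hT, hx] using h2
  -- the tropical values of the monomials
  set u : Fin r ⊕ D.Xi0 → ℝ := fun m =>
    D.coefVal lam m + ∑ i, (x i).order * (D.expo m i : ℝ) with hu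
  -- These are the monomials that do not vanish at z.
  set A : Finset (Fin r ⊕ D.Xi0) :=
    Finset.univ.filter fun m => ∀ i, x i = 0 → D.expo m i = 0 with hA
  have hmemA : ∀ m, m ∈ A ↔ ∀ i, x i = 0 → D.expo m i = 0 := fun m => by simp [hA]
  have hTA : ∀ m ∈ A, T m ≠ 0 ∧ (T m).order = u m := fun m hm => by
    obtain ⟨h1, h2⟩ := D.coef_ne_zero_and_order hb m
    obtain ⟨h3, h4⟩ := HahnSeries.prod_pow_ne_zero_and_order Finset.univ x
      (fun i => (D.expo m i).toNat) fun i _ hi => by simp [(hmemA m).1 hm i hi]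
    refine ⟨mul_ne_zero h1 h3, ?_⟩
    rw [hT, HahnSeries.order_mul h1 h3, h2, h4, hu]
    congr 1
    exact Finset.sum_congr rfl fun i _ => by rw [cast_toNat_expo]
  have hTnA : ∀ m ∉ A, T m = 0 := fun m hm => by
    rw [hmemA] at hm
    push Not at hm
    obtain ⟨i, hxi, hi⟩ := hm
    have := D.expo_nonneg m i
    rw [hT]
    simp only
    rw [Finset.prod_eq_zero (Finset.mem_univ i), mul_zero]
    rw [hxi]
    exact zero_pow (by omega)
  obtain ⟨m0, hm0, hmin⟩ := Finset.exists_min_image A u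
    ⟨Sum.inr ⟨Pi.single i0 (D.d i0 : ℤ), D.single_mem_Xi0 i0⟩, (hmemA _).2 fun i hi => by
      have : i ≠ i0 := fun h => hi0 ((hxz i0).1 (h ▸ hi))
      simp [expo, this]⟩
  set μ := u m0 with hμ
  -- N replaces the infinite valuation of a vanishing coordinate. The order of 0 is 0 by convention,
  -- and a monomial outside A contains such a coordinate, so the replacement raises its value by at
  -- least N ≥ |u m| + |μ|, hence to at least μ.
  set N : ℝ := ∑ m, |u m| + |μ| with hN
  have hN0 : 0 ≤ N := by positivity
  set v : (Σ j, I j) → ℝ := fun i => if x i = 0 then N else (x i).order with hv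
  have hvterm : ∀ m i, (x i).order * (D.expo m i : ℝ) ≤ v i * (D.expo m i : ℝ) := fun m i => by
    have h1 : (0 : ℝ) ≤ D.expo m i := by exact_mod_cast D.expo_nonneg m i
    refine mul_le_mul_of_nonneg_right ?_ h1
    simp only [hv]
    split_ifs with h
    · simpa [h] using hN0
    · exact le_rfl
  have hvA : ∀ m ∈ A, D.coefVal lam m + ∑ i, v i * (D.expo m i : ℝ) = u m := fun m hm => by
    rw [hu]
    congr 1
    refine Finset.sum_congr rfl fun i _ => ?_
    by_cases h : x i = 0
    · simp [(hmemA m).1 hm i h]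
    · simp [hv, h]
  have hvnA : ∀ m ∉ A, μ ≤ D.coefVal lam m + ∑ i, v i * (D.expo m i : ℝ) := fun m hm => by
    rw [hmemA] at hm
    push Not at hm
    obtain ⟨i, hxi, hi⟩ := hm
    have h1 : (1 : ℝ) ≤ D.expo m i := by
      have := D.expo_nonneg m i
      exact_mod_cast (by omega : 1 ≤ D.expo m i)
    have h2 : N ≤ ∑ i, (v i * (D.expo m i : ℝ) - (x i).order * (D.expo m i : ℝ)) := by
      refine le_trans ?_ (Finset.single_le_sum (f := fun i =>
        v i * (D.expo m i : ℝ) - (x i).order * (D.expo m i : ℝ))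
        (fun k _ => sub_nonneg.2 (hvterm m k)) (Finset.mem_univ i))
      simp only [hv, hxi, if_true, HahnSeries.order_zero, zero_mul, sub_zero]
      exact le_mul_of_one_le_right hN0 h1
    have h3 : |u m| ≤ ∑ m, |u m| := Finset.single_le_sum (f := fun m => |u m|)
      (fun _ _ => abs_nonneg _) (Finset.mem_univ m)
    have h4 := neg_abs_le (u m)
    have h5 := le_abs_self μ
    rw [Finset.sum_sub_distrib] at h2
    have h6 : u m = D.coefVal lam m + ∑ i, (x i).order * (D.expo m i : ℝ) := rfl
    linarith
  have hvall : ∀ m, μ ≤ D.coefVal lam m + ∑ i, v i * (D.expo m i : ℝ) := fun m => by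
    by_cases hm : m ∈ A
    · rw [hvA m hm]; exact hmin m hm
    · exact hvnA m hm
  have hcoeff : ∀ m, (T m).coeff μ ≠ 0 →
      D.coefVal lam m + ∑ i, v i * (D.expo m i : ℝ) = μ := fun m hm => by
    have hmA : m ∈ A := by
      by_contra h
      exact hm (by rw [hTnA m h, HahnSeries.coeff_zero])
    rw [hvA m hmA]
    refine le_antisymm ?_ (hmin m hmA)
    rw [← (hTA m hmA).2]
    exact HahnSeries.order_le_of_coeff_ne_zero hm
  have hsum : ∀ i, ∑ m, (T m).coeff μ * (D.expo m i : ℂ) = 0 := fun i => by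
    have h1 := congrArg (fun f : HahnSeries ℝ ℂ => f.coeff μ) (heuler i)
    simp only [HahnSeries.coeff_sum, HahnSeries.coeff_nsmul, Pi.smul_apply, HahnSeries.coeff_zero] at h1
    rw [← h1]
    exact Finset.sum_congr rfl fun m _ => by rw [nsmul_eq_mul, cast_toNat_expo, mul_comm]
  -- The independence is over ℝ, so the complex relation is split into real and imaginary parts.
  have hre := D.eq_zero_of_sum_mul_expo_eq_zero lam hlam hMPCP v μ hvall
    (fun m => ((T m).coeff μ).re) (fun m hm => hcoeff m fun h => hm (by simp [h]))
    (fun i => by simpa using congrArg Complex.re (hsum i)) m0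
  have him := D.eq_zero_of_sum_mul_expo_eq_zero lam hlam hMPCP v μ hvall
    (fun m => ((T m).coeff μ).im) (fun m hm => hcoeff m fun h => hm (by simp [h]))
    (fun i => by simpa using congrArg Complex.im (hsum i)) m0
  -- The coefficient of T m0 at its own order μ would vanish, although T m0 is nonzero.
  obtain ⟨hT0, hTord⟩ := hTA m0 hm0
  refine hT0 (HahnSeries.coeff_order_eq_zero.1 ?_)
  rw [hTord]
  exact Complex.ext hre him

end GreenePlesserData

theorem mainTheorem3 {r : ℕ} {I : Fin r → Type*} [∀ j, Fintype (I j)] [∀ j, DecidableEq (I j)]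
    (D : GreenePlesserData I) (lam : D.Xi0 → ℝ) (hlam : ∀ p, 0 < lam p) (hMPCP : D.MPCP lam)
    (b : D.Xi0 → Novikov) (hb : ∀ p, Novikov.val (b p) = (lam p : WithTop ℝ)) :
    HasIsolatedSingularityAtOrigin (D.W b) :=
  ⟨D.eval_zero_W b, D.zero_mem_criticalLocus_W b, 1, by simp, fun z hz _ =>
    D.eq_zero_of_mem_criticalLocus_W lam hlam hMPCP b hb z hz⟩
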